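/- **Parameters.** Let $\mathbf N$ be the set of tuples $\mathbf n=(T,\mathrm{nor},\bar\lambda,\bar\mu)$ such that: - $T\subseteq\omega^{<\omega}$ is a non-empty set closed under initial segments; $\bar\lambda=(\lambda_\eta:\eta\in T)$ are pairwise distinct non-zero natural numbers with $\eta^\frown m\in T\iff m<\lambda_\eta$ for all $\eta\in T$, $m\in\omega$; $\bar\mu=(\mu_\eta:\eta\in T)$ are non-negative reals. Write $\mathrm{suc}_S(\eta)$ for the set of immediate successors of $\eta$ in a tree $S$. - If $\mathrm{lg}(\eta)=\mathrm{lg}(\nu)$ and $\eta<_{lex}\nu$, or if $\mathrm{lg}(\eta)<\mathrm{lg}(\nu)$, then $\lambda_\eta<\lambda_\nu$; and $\mathrm{lg}(\eta)<\mu_\eta<\lambda_\eta$ for all $\eta\in T$. - For $\eta\in T$, $\mathrm{nor}_\eta$ assigns to each non-empty $a\subseteq\mathrm{suc}_T(\eta)$ a real $\mathrm{nor}_\eta(a)\ge 0$, monotonically with respect to inclusion, and $(\mathrm{lg}(\eta)+1)^2\le\mu_\eta\le\mathrm{nor}_\eta(\mathrm{suc}_T(\eta))$. - $\prod\{\lambda_\nu:\nu\in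 T,\ \lambda_\nu<\lambda_\eta\}<\mu_\eta$. - (Co-bigness) If $k>0$ is real, $1\le j\le\mu_\eta$, and $a_0,\dots,a_{j-1}\subseteq\mathrm{suc}_T(\eta)$ are non-empty with $\mathrm{nor}_\eta(a_i)\ge k+\frac1{\mu_\eta}$ for all $i<j$, then $\bigcap_{i<j}a_i\neq\emptyset$ and $\mathrm{nor}_\eta(\bigcap_{i<j}a_i)\ge k$. - If $\mathrm{nor}_\eta(a)\ge 1$ then $|a|>\frac12|\mathrm{suc}_T(\eta)|$. - If $k>0$, $\mathrm{nor}_\eta(a)\ge k+\frac1{\mu_\eta}$, $\rho\in a$ and $a\setminus\{\rho\}\ne\emptyset$, then $\mathrm{nor}_\eta(a\setminus\{\rho\})\ge k$. **The forcing.** For $\mathbf n\in\mathbf N$, a condition $p\in\mathbb Q^1_{\mathbf n}$ is a subtree $T_p\subseteq T$ (closed under initial segments, without maximal nodes) with a trunk $\mathrm{tr}(p)\in T_p$, such that every node of $T_p$ is comparable with $\mathrm{tr}(p)$; along every infinite branch $x$ of $T_p$ the norms $\mathrm{nor}_{x\restriction l}(\mathrm{suc}_{T_p}(x\restriction l))$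 tend to $\infty$; $\mathrm{nor}_\eta(\mathrm{suc}_{T_p}(\eta))\ge 2-\frac1{\mu_{\mathrm{tr}(p)}}$ for all $\eta\in T_p$ extending $\mathrm{tr}(p)$; and for every $N<\omega$ there is $k>\mathrm{lg}(\mathrm{tr}(p))$ such that $\mathrm{nor}_\eta(\mathrm{suc}_{T_p}(\eta))\ge N$ for all $\eta\in T_p$ with $\mathrm{lg}(\eta)\ge k$. A condition $q$ is stronger than $p$ iff $T_q\subseteq T_p$. Hechler forcing $\mathbb D$ consists of the pairs $(s,f)$ with $s\in\omega^{<\omega}$ an initial segment of $f\in\omega^\omega$; $(t,g)$ is stronger than $(s,f)$ iff $s$ is an initial segment of $t$ and $f(i)\le g(i)$ for all $i$. A real $x\in\omega^\omega$ is a Hechler real over the ground model $V$ if the set of all $(s,f)\in\mathbb D^V$ such that $s$ is an initial segment of $x$ and $f(i)\le x(i)$ for all $i$ is a $V$-generic filter on $\mathbb D^V$. **Claim.** For every $\mathbf n\in\mathbf N$: (a) $\mathbb Q^1_{\mathbf n}$ adds a dominating real: there is a $\mathbb Q^1_{\mathbf n}$-name $\tau$ of a member of $\omega^\omega$ such that for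 every $h\in\omega^\omega$ of the ground model, $\Vdash$ "$h(i)\le\tau(i)$ for all but finitely many $i$". (b) $\mathbb Q^1_{\mathbf n}$ adds a Hechler real: there is a $\mathbb Q^1_{\mathbf n}$-name $\rho$ of a member of $\omega^\omega$ such that $\Vdash$ "$\rho$ is a Hechler real over the ground model". -/

import Mathlib

/-! ### Forcing notions and names of reals

Forcing notions are preorders in which larger conditions are stronger. -/

namespace Forcing

/-- A (nice) `P`-name of a member of `ω^ω`: the name `{((i,m)ˇ, c) : c ∈ rel i m}` of a set of
pairs, which is forced by every condition to be a total function from `ω` to `ω`. -/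
structure RealName (P : Type*) [Preorder P] where
  rel : ℕ → ℕ → Set P
  total : ∀ (i : ℕ) (p : P), ∃ q, p ≤ q ∧ ∃ m, ∃ c ∈ rel i m, c ≤ q
  functional : ∀ (i m m' : ℕ) (c c' r : P), c ∈ rel i m → c' ∈ rel i m' →
    c ≤ r → c' ≤ r → m = m'

namespace RealName

variable {P : Type*} [Preorder P]

/-- `p ⊩ τ(i) = m`. -/
def ForcesEq (τ : RealName P) (p : P) (i m : ℕ) : Prop :=
  ∀ q, p ≤ q → ∃ r, q ≤ r ∧ ∃ c ∈ τ.rel i m, c ≤ r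

/-- `p ⊩ τ(i) ≥ k`, that is, `p ⊩ ∃ m ≥ k, τ(i) = m`. -/
def ForcesGe (τ : RealName P) (p : P) (i k : ℕ) : Prop :=
  ∀ q, p ≤ q → ∃ r, q ≤ r ∧ ∃ m, k ≤ m ∧ τ.ForcesEq r i m

/-- `p ⊩ ∃ j, ∀ i ≥ j, h(i) ≤ τ(i)`, for a real `h` of the ground model. -/
def ForcesDominates (τ : RealName P) (p : P) (h : ℕ → ℕ) : Prop :=
  ∀ q, p ≤ q → ∃ r, q ≤ r ∧ ∃ j : ℕ, ∀ i, j ≤ i → τ.ForcesGe r i (h i)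

/-- Every condition forces that `τ` is a dominating real over the ground model. -/
def IsDominating (τ : RealName P) : Prop :=
  ∀ (p : P) (h : ℕ → ℕ), τ.ForcesDominates p h

end RealName

/-- Hechler forcing: pairs `(stem, fn)` with `stem ∈ ω^{<ω}` an initial segment of
`fn ∈ ω^ω`. -/
structure Hechler where
  stem : List ℕ
  fn : ℕ → ℕ
  stem_eq : ∀ (i : ℕ) (hi : i < stem.length), fn i = stem[i]

instance : Preorder Hechler where
  le d e := d.stem <+: e.stem ∧ ∀ i, d.fn i ≤ e.fn i
  le_refl d := ⟨List.prefix_refl _, fun _ => le_refl _⟩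
  le_trans _ _ _ h₁ h₂ := ⟨h₁.1.trans h₂.1, fun i => (h₁.2 i).trans (h₂.2 i)⟩

namespace RealName

variable {P : Type*} [Preorder P]

/-- `p ⊩ d ∈ G_τ`, where `G_x`, for a real `x`, is the set of all `(s, f)` in Hechler forcing
such that `s` is an initial segment of `x` and `f(i) ≤ x(i)` for all `i`. -/
def ForcesMem (τ : RealName P) (p : P) (d : Hechler) : Prop :=
  (∀ (i : ℕ) (hi : i < d.stem.length), τ.ForcesEq p i d.stem[i]) ∧
    ∀ i, τ.ForcesGe p i (d.fn i)

/-- Every condition forces that `τ` is a Hechler real over the ground model: `G_τ` is a filter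
on Hechler forcing (of the ground model) that meets every dense set of the ground model. -/
structure IsHechler (τ : RealName P) : Prop where
  downward : ∀ (p : P) (d e : Hechler), d ≤ e → τ.ForcesMem p e → τ.ForcesMem p d
  directed : ∀ (p : P) (d e : Hechler), τ.ForcesMem p d → τ.ForcesMem p e →
    ∀ q, p ≤ q → ∃ r, q ≤ r ∧ ∃ g, d ≤ g ∧ e ≤ g ∧ τ.ForcesMem r g
  generic : ∀ D : Set Hechler, (∀ d, ∃ e ∈ D, d ≤ e) →
    ∀ p : P, ∀ q, p ≤ q → ∃ r, q ≤ r ∧ ∃ d ∈ D, τ.ForcesMem r d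

end RealName

end Forcing

/-! ### The parameters and the tree-creature forcing -/

namespace TreeCreature

/-- The immediate successors of `η` in `S`; the successor `η⌢m` is identified with `m`. -/
def suc (S : Set (List ℕ)) (η : List ℕ) : Set ℕ := {m | η ++ [m] ∈ S}

/-- The initial segment of length `l` of `x ∈ ω^ω`. -/
def res (x : ℕ → ℕ) (l : ℕ) : List ℕ := (List.range l).map x

open Classical in
/-- The product of all the numbers `lam ν` (`ν ∈ T`) that are smaller than `lam η`. -/
noncomputable def lamBelow (T : Set (List ℕ)) (lam : List ℕ → ℕ) (η : List ℕ) : ℕ :=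
  ∏ k ∈ (Finset.range (lam η)).filter (fun k => ∃ ν ∈ T, lam ν = k), k

/-- The parameters. Only the values of `lam` and `mu` at nodes of `T`, and of `nor η` at
non-empty subsets of `suc T η` for `η ∈ T`, are relevant. The relation `≪` is read as `<`, its
weakest sense. -/
structure Param where
  T : Set (List ℕ)
  lam : List ℕ → ℕ
  mu : List ℕ → ℝ
  nor : List ℕ → Set ℕ → ℝ
  root_mem : [] ∈ T
  prefix_mem : ∀ η ∈ T, ∀ ν, ν <+: η → ν ∈ T
  mu_nonneg : ∀ η ∈ T, 0 ≤ mu η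
  lam_ne_zero : ∀ η ∈ T, lam η ≠ 0
  lam_injOn : Set.InjOn lam T
  suc_eq : ∀ η ∈ T, suc T η = Set.Iio (lam η)
  lam_lex : ∀ η ∈ T, ∀ ν ∈ T, η.length = ν.length → List.Lex (· < ·) η ν → lam η < lam ν
  length_lt_lam : ∀ η ∈ T, η.length < lam η
  lam_lt_lam : ∀ η ∈ T, ∀ ν ∈ T, η.length < ν.length → lam η < lam ν
  length_lt_mu : ∀ η ∈ T, (η.length : ℝ) < mu η
  mu_lt_lam : ∀ η ∈ T, mu η < lam η
  nor_nonneg : ∀ η ∈ T, ∀ a ⊆ suc T η, a.Nonempty → 0 ≤ nor η a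
  nor_mono : ∀ η ∈ T, ∀ a b : Set ℕ, a.Nonempty → a ⊆ b → b ⊆ suc T η → nor η a ≤ nor η b
  sq_le_mu : ∀ η ∈ T, ((η.length : ℝ) + 1) ^ 2 ≤ mu η
  mu_le_nor : ∀ η ∈ T, mu η ≤ nor η (suc T η)
  lamBelow_lt_mu : ∀ η ∈ T, (lamBelow T lam η : ℝ) < mu η
  /-- co-bigness -/
  coBig : ∀ η ∈ T, ∀ k : ℝ, 0 < k → ∀ (j : ℕ) (a : Fin j → Set ℕ), 0 < j → (j : ℝ) ≤ mu η →
    (∀ i, (a i).Nonempty ∧ a i ⊆ suc T η ∧ k + 1 / mu η ≤ nor η (a i)) →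
    (⋂ i, a i).Nonempty ∧ k ≤ nor η (⋂ i, a i)
  half_lt : ∀ η ∈ T, ∀ a ⊆ suc T η, a.Nonempty → 1 ≤ nor η a →
    (1 / 2 : ℝ) < (a.ncard : ℝ) / ((suc T η).ncard : ℝ)
  nor_diff : ∀ η ∈ T, ∀ k : ℝ, 0 < k → ∀ a ⊆ suc T η, ∀ m ∈ a, (a \ {m}).Nonempty →
    k + 1 / mu η ≤ nor η a → k ≤ nor η (a \ {m})

/-- `S` is (the tree of) a condition of `ℚ⁰_n` with trunk `s`. -/
structure IsQ0 (n : Param) (s : List ℕ) (S : Set (List ℕ)) : Prop where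
  trunk_mem : s ∈ S
  subset_T : ∀ η ∈ S, η ∈ n.T ∧ (η <+: s ∨ s <+: η)
  prefix_mem : ∀ η ∈ S, ∀ ν, ν <+: η → ν ∈ S
  no_max : ∀ η ∈ S, ∃ m, η ++ [m] ∈ S
  nor_tendsto : ∀ x : ℕ → ℕ, (∀ l, res x l ∈ S) →
    Filter.Tendsto (fun l => n.nor (res x l) (suc S (res x l))) Filter.atTop Filter.atTop
  /-- the infimum of the norms at the nodes above the trunk is at least `2 - 1/μ_s` -/
  le_nor : ∀ η ∈ S, s <+: η → 2 - 1 / n.mu s ≤ n.nor η (suc S η)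

/-- The forcing notion `ℚ¹_n`. -/
structure Q1 (n : Param) where
  trunk : List ℕ
  tree : Set (List ℕ)
  isQ0 : IsQ0 n trunk tree
  uniform : ∀ N : ℕ, ∃ k : ℕ, trunk.length < k ∧
    ∀ η ∈ tree, k ≤ η.length → (N : ℝ) ≤ n.nor η (suc tree η)

instance (n : Param) : Preorder (Q1 n) where
  le p q := q.tree ⊆ p.tree
  le_refl p := Set.Subset.refl p.tree
  le_trans _ _ _ h₁ h₂ := Set.Subset.trans h₂ h₁

end TreeCreature

/-!
Colour the successors of each node `η` by a rank such that every set of successors of large norm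
realises all small ranks, while inside such a set the successors of bounded rank still have large
norm: `⌊nor_η {0, …, m} / 4⌋` is such a colouring, by co-bigness and since removing a point from an
initial segment hardly lowers its norm. Above a long enough node one can therefore prescribe the
ranks along a branch, up to a slow bound, and then bound all further ranks by any function `V → ∞`.
So the sequence `c` of ranks along the generic branch is generic for the pairs (finite word, slow
bound).

Let `ρ i` be the least `l` such that `c l` has the binary digit of weight `2 ^ i`. Prescribing
letters of `c` prescribes an initial segment of `ρ`, with arbitrary large values since the bound on
the letters tends to infinity. Conversely a slow enough bound on the later letters keeps the digit
of weight `2 ^ i` away until `l ≥ f i`, which forces `ρ i ≥ f i`. Hence `ρ` is a Hechler real, and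
Hechler reals are dominating.
-/

namespace Forcing

open Filter

namespace Hechler

/-- The Hechler condition `(f ↾ k, f)`; every Hechler condition has this form. -/
def ofFn (f : ℕ → ℕ) (k : ℕ) : Hechler where
  stem := (List.range k).map f
  fn := f
  stem_eq i hi := by simp

@[simp]
lemma length_stem_ofFn (f : ℕ → ℕ) (k : ℕ) : (ofFn f k).stem.length = k := by
  simp [ofFn]

@[simp]
lemma fn_ofFn (f : ℕ → ℕ) (k : ℕ) : (ofFn f k).fn = f := rfl

lemma le_iff {d e : Hechler} :
    d ≤ e ↔ d.stem.length ≤ e.stem.length ∧ (∀ i < d.stem.length, e.fn i = d.fn i) ∧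
      ∀ i, d.fn i ≤ e.fn i := by
  change d.stem <+: e.stem ∧ _ ↔ _
  rw [List.prefix_iff_getElem, ← and_assoc, ← exists_prop (a := _ ≤ _)]
  refine and_congr_left' (exists_congr fun hle => forall₂_congr fun i hi => ?_)
  rw [d.stem_eq i hi, e.stem_eq i (hi.trans_le hle), eq_comm]

end Hechler

namespace RealName

variable {P : Type*} [Preorder P] {τ c : RealName P} {p q : P} {i k l m m' : ℕ}

lemma ForcesEq.mono (h : τ.ForcesEq p i m) (hpq : p ≤ q) : τ.ForcesEq q i m :=
  fun r hr => h r (hpq.trans hr)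

lemma ForcesEq.unique (h : τ.ForcesEq p i m) (h' : τ.ForcesEq p i m') : m = m' := by
  obtain ⟨r, hr, c, hc, hcr⟩ := h p le_rfl
  obtain ⟨r', hr', c', hc', hcr'⟩ := h' r hr
  exact τ.functional i m m' c c' r' hc hc' (hcr.trans hr') hcr'

lemma forcesEq_of_mem_rel (h : p ∈ τ.rel i m) : τ.ForcesEq p i m :=
  fun q hq => ⟨q, le_rfl, p, h, hq⟩

lemma ForcesGe.mono (h : τ.ForcesGe p i k) (hpq : p ≤ q) : τ.ForcesGe q i k :=
  fun r hr => h r (hpq.trans hr)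

lemma ForcesGe.of_le (h : τ.ForcesGe p i k) (hm : m ≤ k) : τ.ForcesGe p i m := by
  intro q hq
  obtain ⟨r, hr, v, hv, hrv⟩ := h q hq
  exact ⟨r, hr, v, hm.trans hv, hrv⟩

lemma ForcesEq.forcesGe (h : τ.ForcesEq p i m) : τ.ForcesGe p i m :=
  fun q hq => ⟨q, le_rfl, m, le_rfl, h.mono hq⟩

lemma ForcesGe.le_of_forcesEq (h : τ.ForcesGe p i k) (h' : τ.ForcesEq p i m) : k ≤ m := by
  obtain ⟨r, hr, v, hv, hrv⟩ := h p le_rfl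
  exact hv.trans_eq (hrv.unique (h'.mono hr))

/-- `p ⊩ τ(i) ≤ k`, that is, `p ⊩ ∃ m ≤ k, τ(i) = m`. -/
def ForcesLe (τ : RealName P) (p : P) (i k : ℕ) : Prop :=
  ∀ q, p ≤ q → ∃ r, q ≤ r ∧ ∃ m ≤ k, τ.ForcesEq r i m

lemma ForcesLe.mono (h : τ.ForcesLe p i k) (hpq : p ≤ q) : τ.ForcesLe q i k :=
  fun r hr => h r (hpq.trans hr)

lemma ForcesLe.le_of_forcesEq (h : τ.ForcesLe p i k) (h' : τ.ForcesEq p i m) : m ≤ k := by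
  obtain ⟨r, hr, v, hv, hrv⟩ := h p le_rfl
  exact ((h'.mono hr).unique hrv).trans_le hv

lemma forcesMem_iff {d : Hechler} :
    τ.ForcesMem p d ↔
      (∀ i < d.stem.length, τ.ForcesEq p i (d.fn i)) ∧ ∀ i, τ.ForcesGe p i (d.fn i) :=
  and_congr_left' (forall₂_congr fun i hi => by rw [d.stem_eq i hi])

lemma ForcesMem.mono {d : Hechler} (h : τ.ForcesMem p d) (hpq : p ≤ q) : τ.ForcesMem q d :=
  ⟨fun i hi => (h.1 i hi).mono hpq, fun i => (h.2 i).mono hpq⟩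

lemma ForcesMem.of_le {d e : Hechler} (he : τ.ForcesMem p e) (hde : d ≤ e) :
    τ.ForcesMem p d := by
  rw [forcesMem_iff] at he ⊢
  obtain ⟨hlen, hstem, hfn⟩ := Hechler.le_iff.1 hde
  exact ⟨fun i hi => hstem i hi ▸ he.1 i (hi.trans_le hlen), fun i => (he.2 i).of_le (hfn i)⟩

lemma ForcesMem.exists_le_le_of_length_le {d e : Hechler} (hd : τ.ForcesMem p d)
    (he : τ.ForcesMem p e) (hde : d.stem.length ≤ e.stem.length) :
    ∃ g, d ≤ g ∧ e ≤ g ∧ τ.ForcesMem p g := by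
  rw [forcesMem_iff] at hd he
  have hmax : ∀ i < e.stem.length, max (d.fn i) (e.fn i) = e.fn i := fun i hi =>
    max_eq_right ((hd.2 i).le_of_forcesEq (he.1 i hi))
  refine ⟨.ofFn (fun i => max (d.fn i) (e.fn i)) e.stem.length, Hechler.le_iff.2 ?_,
    Hechler.le_iff.2 ?_, forcesMem_iff.2 ⟨?_, fun i => ?_⟩⟩
  · rw [Hechler.length_stem_ofFn, Hechler.fn_ofFn]
    refine ⟨hde, fun i hi => (hmax i (hi.trans_le hde)).trans ?_, fun i => le_max_left _ _⟩
    exact (he.1 i (hi.trans_le hde)).unique (hd.1 i hi)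
  · rw [Hechler.length_stem_ofFn, Hechler.fn_ofFn]
    exact ⟨le_rfl, hmax, fun i => le_max_right _ _⟩
  · rw [Hechler.length_stem_ofFn, Hechler.fn_ofFn]
    exact fun i hi => (hmax i hi).symm ▸ he.1 i hi
  · rw [Hechler.fn_ofFn]
    rcases max_choice (d.fn i) (e.fn i) with h | h
    exacts [h.symm ▸ hd.2 i, h.symm ▸ he.2 i]

lemma ForcesMem.directed {d e : Hechler} (hd : τ.ForcesMem p d) (he : τ.ForcesMem p e) :
    ∃ g, d ≤ g ∧ e ≤ g ∧ τ.ForcesMem p g := by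
  rcases le_total d.stem.length e.stem.length with h | h
  · exact hd.exists_le_le_of_length_le he h
  · obtain ⟨g, heg, hdg, hg⟩ := he.exists_le_le_of_length_le hd h
    exact ⟨g, hdg, heg, hg⟩

lemma isHechler_of_forall_exists_reduction
    (h : ∀ p, ∃ d : Hechler, ∀ e, d ≤ e → ∃ q, p ≤ q ∧ τ.ForcesMem q e) : τ.IsHechler where
  downward _ _ _ hde he := he.of_le hde
  directed _ _ _ hd he q hq := ⟨q, le_rfl, (hd.mono hq).directed (he.mono hq)⟩
  generic D hD _ q _ := by
    obtain ⟨d, hd⟩ := h q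
    obtain ⟨e, heD, hde⟩ := hD d
    obtain ⟨r, hqr, hr⟩ := hd e hde
    exact ⟨r, hqr, e, heD, hr⟩

lemma IsHechler.isDominating (hτ : τ.IsHechler) : τ.IsDominating := by
  intro p h q hq
  have hdense : ∀ d : Hechler, ∃ e ∈ {e : Hechler | ∃ j, ∀ i, j ≤ i → h i ≤ e.fn i}, d ≤ e := by
    intro d
    refine ⟨.ofFn (fun i => if i < d.stem.length then d.fn i else max (d.fn i) (h i))
      d.stem.length, ⟨d.stem.length, fun i hi => ?_⟩, Hechler.le_iff.2 ?_⟩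
    · simp [hi.not_gt]
    · refine ⟨by simp, fun i hi => if_pos hi, fun i => ?_⟩
      simp only [Hechler.fn_ofFn]
      split_ifs
      exacts [le_rfl, le_max_left _ _]
  obtain ⟨r, hr, d, ⟨j, hj⟩, hd⟩ := hτ.generic _ hdense p q hq
  exact ⟨r, hr, j, fun i hi => (hd.2 i).of_le (hj i hi)⟩

end RealName

/-- `l` is the first place at which the real `x` has the binary digit of weight `2 ^ i`. The map
sending `i` to this `l` turns a real that is generic for the pairs (finite word, slow bound) into a
Hechler real. -/
def IsFirstBit (x : ℕ → ℕ) (i l : ℕ) : Prop := IsLeast {j | (x j).testBit i} l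

lemma exists_isFirstBit {x : ℕ → ℕ} {i l : ℕ} (h : (x l).testBit i) :
    ∃ j, IsFirstBit x i j := by
  classical
  have hex : ∃ j, (x j).testBit i := ⟨l, h⟩
  exact ⟨Nat.find hex, Nat.find_spec hex, fun _ hj => Nat.find_min' hex hj⟩

lemma exists_tendsto_comp_le (g : ℕ → ℕ) :
    ∃ W : ℕ → ℕ, Tendsto W atTop atTop ∧ ∀ l, g 0 ≤ l → g (W l) ≤ l := by
  refine ⟨fun l => Nat.findGreatest (fun i => g i ≤ l) l, tendsto_atTop.2 fun i => ?_,
    fun l hl => Nat.findGreatest_spec (P := fun i => g i ≤ l) (Nat.zero_le l) hl⟩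
  filter_upwards [eventually_ge_atTop i, eventually_ge_atTop (g i)] with l hil hgl
  exact Nat.le_findGreatest hil hgl

lemma exists_isFirstBit_extension {x W : ℕ → ℕ} {k M : ℕ}
    (hx : ∀ i l, (x l).testBit i → l < k ∧ i < M) {f : ℕ → ℕ} {N : ℕ} (hMN : M ≤ N)
    (hf : ∀ i < M, IsFirstBit x i (f i))
    (hfk : ∀ i, M ≤ i → k ≤ f i ∧ 2 ^ (i + 1) ≤ W (f i)) :
    ∃ y : ℕ → ℕ, (∀ l < k, y l = x l) ∧ (∀ l, k ≤ l → y l ≤ W l) ∧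
      (∀ i < N, IsFirstBit y i (f i)) ∧ ∀ i l, (y l).testBit i → i < N := by
  obtain ⟨y, hy⟩ : ∃ y : ℕ → ℕ, ∀ l i, (y l).testBit i ↔
      (x l).testBit i ∨ i < N ∧ M ≤ i ∧ f i = l := by
    refine ⟨fun l => x l ||| Nat.ofBits fun i : Fin N => decide (M ≤ i.1 ∧ f i = l),
      fun l i => ?_⟩
    rcases lt_or_ge i N with hi | hi
    · simp [hi]
    · simp [hi, hi.not_gt]
  refine ⟨y, fun l hl => ?_, fun l hl => ?_, fun i hi => ?_, fun i l hil => ?_⟩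
  · refine Nat.eq_of_testBit_eq fun i => Bool.eq_iff_iff.2 ?_
    rw [hy, or_iff_left]
    rintro ⟨-, hMi, rfl⟩
    exact (hfk i hMi).1.not_gt hl
  · by_cases h0 : y l = 0
    · exact h0 ▸ Nat.zero_le _
    obtain ⟨i, hi, hmax⟩ := Nat.exists_most_significant_bit h0
    obtain ⟨-, hMi, rfl⟩ := ((hy l i).1 hi).resolve_left fun h => hl.not_gt (hx i l h).1
    have hlt : y (f i) < 2 ^ (i + 1) := Nat.lt_pow_two_of_testBit _ fun j hj => hmax j hj
    exact hlt.le.trans (hfk i hMi).2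
  · rcases lt_or_ge i M with hiM | hiM
    · have hyi (l : ℕ) : (y l).testBit i ↔ (x l).testBit i := by
        rw [hy, or_iff_left fun h => h.2.1.not_gt hiM]
      simpa only [IsFirstBit, hyi] using hf i hiM
    · have hyi (l : ℕ) : (y l).testBit i ↔ f i = l := by
        rw [hy, or_iff_right fun h => hiM.not_gt (hx i l h).2]
        exact ⟨fun h => h.2.2, fun h => ⟨hi, hiM, h⟩⟩
      exact ⟨(hyi _).2 rfl, fun l hl => ((hyi l).1 hl).le⟩
  · exact ((hy l i).1 hil).elim (fun h => (hx i l h).2.trans_le hMN) fun h => h.1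

namespace RealName

variable {P : Type*} [Preorder P] {c : RealName P} {p : P}

/-- Suppose that `c` is generic for the forcing of pairs `(σ, W)` of a finite word and a function
`W → ∞`, where a stronger condition `(τ, V)` lengthens `σ` by letters `τ(l) ≤ W(l)`. This says that
`(x ↾ k, W)` is a reduction of `p`: each `(y ↾ j, V)` stronger than it is compatible with `p`. -/
def IsReduction (c : RealName P) (p : P) (k : ℕ) (x W : ℕ → ℕ) : Prop :=
  ∀ j, k ≤ j → ∀ y : ℕ → ℕ, (∀ l < k, y l = x l) → (∀ l, k ≤ l → l < j → y l ≤ W l) →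
    ∀ V : ℕ → ℕ, Tendsto V atTop atTop →
      ∃ q, p ≤ q ∧ (∀ l < j, c.ForcesEq q l (y l)) ∧ ∀ l, j ≤ l → c.ForcesLe q l (V l)

/-- `c` is a generic real for the forcing of pairs `(σ, W)` described at `IsReduction`. -/
def IsSlowGeneric (c : RealName P) : Prop :=
  ∀ p, ∃ k x W, Tendsto W atTop atTop ∧ c.IsReduction p k x W

lemma IsReduction.extend {k j : ℕ} {x y W : ℕ → ℕ} (h : c.IsReduction p k x W) (hkj : k ≤ j)
    (hyx : ∀ l < k, y l = x l) (hyW : ∀ l, k ≤ l → l < j → y l ≤ W l) :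
    c.IsReduction p j y W := by
  intro j' hjj' y' hy'y hy'W V hV
  refine h j' (hkj.trans hjj') y' (fun l hl => ?_) (fun l hkl hlj' => ?_) V hV
  · rw [hy'y l (hl.trans_le hkj), hyx l hl]
  · rcases lt_or_ge l j with hl | hl
    · exact (hy'y l hl).trans_le (hyW l hkl hl)
    · exact hy'W l hl hlj'

lemma IsSlowGeneric.exists_isReduction_testBit (hc : c.IsSlowGeneric) (p : P) (N : ℕ) :
    ∃ k x W M, Tendsto W atTop atTop ∧ c.IsReduction p k x W ∧ N ≤ M ∧
      (∀ i l, (x l).testBit i → l < k ∧ i < M) ∧ ∀ i < M, ∃ l, (x l).testBit i := by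
  obtain ⟨k, x, W, hW, hred⟩ := hc p
  let M := N + ∑ l ∈ Finset.range k, x l
  obtain ⟨j, hjM, hkj⟩ :=
    ((hW.eventually_ge_atTop (2 ^ M - 1)).and (eventually_ge_atTop k)).exists
  let y (l : ℕ) : ℕ := if l < k then x l else if l = j then 2 ^ M - 1 else 0
  have hy_of_lt (l : ℕ) (hl : l < k) : y l = x l := if_pos hl
  have hyj : y j = 2 ^ M - 1 := by simp [y, hkj.not_gt]
  refine ⟨j + 1, y, W, M, hW, hred.extend (by lia) hy_of_lt fun l hkl _ => ?_,
    Nat.le_add_right _ _, fun i l hil => ?_, fun i hi => ⟨j, by simp [hyj, hi]⟩⟩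
  · simp only [y, hkl.not_gt, if_false]
    split_ifs with hlj
    exacts [hlj ▸ hjM, Nat.zero_le _]
  · rcases lt_or_ge l k with hl | hl
    · rw [hy_of_lt l hl] at hil
      have hix : i < x l := i.lt_two_pow_self.trans_le (Nat.ge_two_pow_of_testBit hil)
      have hxM : x l ≤ ∑ l ∈ Finset.range k, x l :=
        Finset.single_le_sum (fun _ _ => Nat.zero_le _) (Finset.mem_range.2 hl)
      exact ⟨by lia, by lia⟩
    · obtain rfl : l = j := by
        by_contra hlj
        simp [y, hl.not_gt, hlj] at hil
      exact ⟨l.lt_succ_self, by simpa [hyj] using hil⟩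

/-- The name of the real whose value at `i` is the least `l` such that `c(l)` has the binary digit
of weight `2 ^ i`. -/
def firstBit (c : RealName P) (hc : c.IsSlowGeneric) : RealName P where
  rel i l := {q | ∃ x, IsFirstBit x i l ∧ ∀ j ≤ l, c.ForcesEq q j (x j)}
  total i p := by
    obtain ⟨k, x, W, M, hW, hred, hiM, hx, hxM⟩ := hc.exists_isReduction_testBit p (i + 1)
    obtain ⟨q, hpq, hq, -⟩ := hred k le_rfl x (fun _ _ => rfl) (fun _ _ _ => by lia) W hW
    obtain ⟨l, hl⟩ := hxM i hiM
    obtain ⟨m, hm⟩ := exists_isFirstBit hl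
    exact ⟨q, hpq, m, q, ⟨x, hm, fun j hj => hq j (hj.trans_lt (hx i m hm.1).1)⟩, le_rfl⟩
  functional := by
    have hle {i l l' : ℕ} {q q' r : P} {x x' : ℕ → ℕ} (hx' : IsFirstBit x' i l')
        (hq' : ∀ j ≤ l', c.ForcesEq q' j (x' j)) (hx : IsFirstBit x i l)
        (hq : ∀ j ≤ l, c.ForcesEq q j (x j)) (hqr : q ≤ r) (hqr' : q' ≤ r) : l ≤ l' := by
      by_contra! hlt
      have hxx' : x l' = x' l' :=
        ((hq l' hlt.le).mono hqr).unique ((hq' l' le_rfl).mono hqr')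
      exact hlt.not_ge (hx.2 (show (x l').testBit i from hxx' ▸ hx'.1))
    rintro i l l' q q' r ⟨x, hx, hq⟩ ⟨x', hx', hq'⟩ hqr hqr'
    exact (hle hx' hq' hx hq hqr hqr').antisymm (hle hx hq hx' hq' hqr' hqr)

lemma forcesGe_firstBit (hc : c.IsSlowGeneric) {i k : ℕ}
    (h : ∀ r, p ≤ r → ∀ l v, v.testBit i → c.ForcesEq r l v → k ≤ l) :
    (c.firstBit hc).ForcesGe p i k := by
  intro q hpq
  obtain ⟨r, hqr, l, q', hq', hqr'⟩ := (c.firstBit hc).total i q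
  refine ⟨r, hqr, l, ?_, (forcesEq_of_mem_rel hq').mono hqr'⟩
  obtain ⟨x, hx, hxq'⟩ := hq'
  exact h r (hpq.trans hqr) l (x l) hx.1 ((hxq' l le_rfl).mono hqr')

lemma exists_forcesMem_firstBit (hc : c.IsSlowGeneric) {k : ℕ} {x W : ℕ → ℕ}
    (hred : c.IsReduction p k x W) {d : Hechler} {y : ℕ → ℕ} (hyx : ∀ l < k, y l = x l)
    (hyW : ∀ l, k ≤ l → y l ≤ W l) (hyd : ∀ i < d.stem.length, IsFirstBit y i (d.fn i))
    (hy : ∀ i l, (y l).testBit i → i < d.stem.length) :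
    ∃ q, p ≤ q ∧ (c.firstBit hc).ForcesMem q d := by
  obtain ⟨V, hV, hVd⟩ := exists_tendsto_comp_le fun v => (Finset.range v).sup d.fn
  let j := k + ∑ i ∈ Finset.range d.stem.length, (d.fn i + 1)
  have hdj (i : ℕ) (hi : i < d.stem.length) : d.fn i < j := by
    have := Finset.single_le_sum (f := fun i => d.fn i + 1) (fun _ _ => Nat.zero_le _)
      (Finset.mem_range.2 hi)
    lia
  obtain ⟨q, hpq, hqy, hqV⟩ :=
    hred j (Nat.le_add_right _ _) y hyx (fun l hkl _ => hyW l hkl) V hV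
  have hstem (i : ℕ) (hi : i < d.stem.length) : (c.firstBit hc).ForcesEq q i (d.fn i) :=
    forcesEq_of_mem_rel ⟨y, hyd i hi, fun l hl => hqy l (hl.trans_lt (hdj i hi))⟩
  refine ⟨q, hpq, forcesMem_iff.2 ⟨hstem, fun i => ?_⟩⟩
  rcases lt_or_ge i d.stem.length with hi | hi
  · exact (hstem i hi).forcesGe
  · refine forcesGe_firstBit hc fun r hqr l v hvi hrv => ?_
    have hjl : j ≤ l := by
      by_contra! hlj
      rw [hrv.unique ((hqy l hlj).mono hqr)] at hvi
      exact hi.not_gt (hy i l hvi)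
    have hiV : i < V l := calc
      i < 2 ^ i := i.lt_two_pow_self
      _ ≤ v := Nat.ge_two_pow_of_testBit hvi
      _ ≤ V l := ((hqV l hjl).mono hqr).le_of_forcesEq hrv
    exact (Finset.le_sup (Finset.mem_range.2 hiV)).trans (hVd l (by simp))

theorem isHechler_firstBit (hc : c.IsSlowGeneric) : (c.firstBit hc).IsHechler := by
  refine isHechler_of_forall_exists_reduction fun p => ?_
  obtain ⟨k, x, W, M, hW, hred, -, hx, hxM⟩ := hc.exists_isReduction_testBit p 0
  have hfirst (i : ℕ) (hi : i < M) : ∃ l, IsFirstBit x i l :=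
    (hxM i hi).elim fun l hl => exists_isFirstBit hl
  choose! a ha using hfirst
  choose g hg using fun i => eventually_atTop.1 (hW.eventually_ge_atTop (2 ^ (i + 1)))
  refine ⟨.ofFn (fun i => if i < M then a i else max k (g i)) M, fun e hde => ?_⟩
  obtain ⟨hMe, hea, hge⟩ := Hechler.le_iff.1 hde
  simp only [Hechler.length_stem_ofFn, Hechler.fn_ofFn] at hMe hea hge
  have hae (i : ℕ) (hi : i < M) : IsFirstBit x i (e.fn i) := by
    rw [hea i hi, if_pos hi]
    exact ha i hi
  have hke (i : ℕ) (hi : M ≤ i) : k ≤ e.fn i ∧ 2 ^ (i + 1) ≤ W (e.fn i) := by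
    have := max_le_iff.1 ((if_neg hi.not_gt).symm.trans_le (hge i))
    exact ⟨this.1, hg i _ this.2⟩
  obtain ⟨y, hyx, hyW, hye, hy⟩ := exists_isFirstBit_extension hx hMe hae hke
  exact exists_forcesMem_firstBit hc hred hyx hyW hye hy

end RealName

end Forcing

namespace TreeCreature

open Filter Set

@[simp]
lemma length_res (x : ℕ → ℕ) (l : ℕ) : (res x l).length = l := by simp [res]

namespace Param

variable {n : Param} {η ν : List ℕ} {m w : ℕ} {k : ℝ} {a b : Set ℕ}

lemma one_lt_lam (hη : η ∈ n.T) : 1 < n.lam η := by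
  have h : (1 : ℝ) < n.lam η := calc
    1 ≤ ((η.length : ℝ) + 1) ^ 2 := one_le_pow₀ (by simp)
    _ ≤ n.mu η := n.sq_le_mu η hη
    _ < n.lam η := n.mu_lt_lam η hη
  exact_mod_cast h

lemma two_le_mu (hη : η ∈ n.T) (hlen : 1 ≤ η.length) : 2 ≤ n.mu η := by
  have h : (1 : ℝ) ≤ η.length := by exact_mod_cast hlen
  nlinarith [n.sq_le_mu η hη]

lemma one_div_mu_le_one (hμ : 2 ≤ n.mu η) : 1 / n.mu η ≤ 1 :=
  (div_le_one (by linarith)).2 (by linarith)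

lemma finite_of_subset_suc (hη : η ∈ n.T) (ha : a ⊆ suc n.T η) : a.Finite :=
  (finite_Iio (n.lam η)).subset (n.suc_eq η hη ▸ ha)

lemma Iic_subset_suc (hη : η ∈ n.T) (hm : m ∈ suc n.T η) : Iic m ⊆ suc n.T η := by
  rw [n.suc_eq η hη] at hm ⊢
  exact Iic_subset_Iio.2 hm

lemma nor_singleton_lt_one (hη : η ∈ n.T) (hm : m ∈ suc n.T η) : n.nor η {m} < 1 := by
  by_contra! h
  have hlam : (2 : ℝ) ≤ n.lam η := by exact_mod_cast one_lt_lam hη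
  have hhalf := n.half_lt η hη {m} (singleton_subset_iff.2 hm) (singleton_nonempty m) h
  rw [n.suc_eq η hη, ncard_singleton, ncard_eq_toFinset_card', toFinset_Iio, Nat.card_Iio,
    Nat.cast_one, lt_div_iff₀ (by linarith)] at hhalf
  linarith

lemma le_nor_inter (hη : η ∈ n.T) (hμ : 2 ≤ n.mu η) (hk : 0 < k) (ha : a.Nonempty)
    (hb : b.Nonempty) (haT : a ⊆ suc n.T η) (hbT : b ⊆ suc n.T η) (hka : k + 1 ≤ n.nor η a)
    (hkb : k + 1 ≤ n.nor η b) : (a ∩ b).Nonempty ∧ k ≤ n.nor η (a ∩ b) := by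
  have hkμ : k + 1 / n.mu η ≤ k + 1 := by linarith [one_div_mu_le_one hμ]
  have h := n.coBig η hη k hk 2 ![a, b] two_pos (by exact_mod_cast hμ)
    (Fin.forall_fin_two.2 ⟨⟨ha, haT, hkμ.trans hka⟩, hb, hbT, hkμ.trans hkb⟩)
  have hab : ⋂ i, (![a, b] : Fin 2 → Set ℕ) i = a ∩ b := by
    ext
    simp [Fin.forall_fin_two]
  rwa [hab] at h

/-- The rank of the successor `m` of `η`: a colouring of the successors of which every set of large
norm realises all small colours, while the successors of bounded colour still have large norm. The
factor `4` leaves room for the two units of norm lost in `le_nor_inter_rank_le`. -/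
noncomputable def rank (n : Param) (η : List ℕ) (m : ℕ) : ℕ := ⌊n.nor η (Iic m) / 4⌋₊

lemma rank_lt_iff (hη : η ∈ n.T) (hm : m ∈ suc n.T η) :
    n.rank η m < w ↔ n.nor η (Iic m) < 4 * w := by
  have h0 := n.nor_nonneg η hη (Iic m) (Iic_subset_suc hη hm) nonempty_Iic
  rw [rank, Nat.floor_lt (by positivity), div_lt_iff₀ four_pos, mul_comm]

lemma rank_zero (hη : η ∈ n.T) (h0 : 0 ∈ suc n.T η) : n.rank η 0 = 0 := by
  have h := nor_singleton_lt_one hη h0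
  have hIic : Iic 0 = ({0} : Set ℕ) := Iic_bot
  rw [← Nat.lt_one_iff, rank_lt_iff hη h0, hIic, Nat.cast_one]
  linarith

lemma nor_lt_of_forall_rank_lt (hη : η ∈ n.T) (ha : a.Nonempty) (haT : a ⊆ suc n.T η)
    (h : ∀ m ∈ a, n.rank η m < w) : n.nor η a < 4 * w := by
  obtain ⟨m, hm, hmax⟩ := exists_max_image a id (finite_of_subset_suc hη haT) ha
  exact (n.nor_mono η hη a (Iic m) ha hmax (Iic_subset_suc hη (haT hm))).trans_lt
    ((rank_lt_iff hη (haT hm)).1 (h m hm))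

/-- Removing its last point from the shortest initial segment with a point of rank `> w` costs at
most `1 / μ_η`. -/
lemma le_nor_rank_le (hη : η ∈ n.T) (hμ : 2 ≤ n.mu η) (hk : 0 < k)
    (hkT : k ≤ n.nor η (suc n.T η)) (hkw : k + 1 ≤ 4 * (w + 1)) :
    k ≤ n.nor η {m ∈ suc n.T η | n.rank η m ≤ w} := by
  classical
  by_cases h : ∃ m, m ∈ suc n.T η ∧ w < n.rank η m
  · obtain ⟨hmT, hwm⟩ := Nat.find_spec h
    set m := Nat.find h
    have hmin : Iic m \ {m} ⊆ {m ∈ suc n.T η | n.rank η m ≤ w} := by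
      rintro i ⟨him, hne⟩
      have hiT : i ∈ suc n.T η := Iic_subset_suc hη hmT him
      exact ⟨hiT, not_lt.1 fun hwi => Nat.find_min h (lt_of_le_of_ne him hne) ⟨hiT, hwi⟩⟩
    have hne : (Iic m \ {m}).Nonempty := by
      refine ⟨0, m.zero_le, fun h0 : 0 = m => ?_⟩
      rw [← h0] at hmT hwm
      simp [rank_zero hη hmT] at hwm
    have hnor : 4 * ((w : ℝ) + 1) ≤ n.nor η (Iic m) := by
      exact_mod_cast not_lt.1 (mt (rank_lt_iff (w := w + 1) hη hmT).2 (by lia))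
    exact (n.nor_diff η hη k hk _ (Iic_subset_suc hη hmT) m self_mem_Iic hne
      (by linarith [one_div_mu_le_one hμ])).trans
      (n.nor_mono η hη _ _ hne hmin (sep_subset _ _))
  · push Not at h
    rwa [sep_eq_self_iff_mem_true.2 h]

lemma le_nor_inter_rank_le (hη : η ∈ n.T) (hμ : 2 ≤ n.mu η) (hk : 0 < k) (hb : b.Nonempty)
    (hbT : b ⊆ suc n.T η) (hkb : k + 1 ≤ n.nor η b) (hkw : k + 2 ≤ 4 * (w + 1)) :
    (b ∩ {m | n.rank η m ≤ w}).Nonempty ∧ k ≤ n.nor η (b ∩ {m | n.rank η m ≤ w}) := by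
  have hlow := le_nor_rank_le (k := k + 1) hη hμ (by linarith)
    (hkb.trans (n.nor_mono η hη b _ hb hbT le_rfl)) (by linarith)
  have hzero : (0 : ℕ) ∈ suc n.T η := n.suc_eq η hη ▸ zero_lt_one.trans (one_lt_lam hη)
  have hinter : b ∩ {m | n.rank η m ≤ w} = b ∩ {m ∈ suc n.T η | n.rank η m ≤ w} := by
    ext m
    exact and_congr_right fun hm => (and_iff_right (hbT hm)).symm
  rw [hinter]
  exact le_nor_inter hη hμ hk hb ⟨0, hzero, (rank_zero hη hzero).trans_le w.zero_le⟩ hbT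
    (sep_subset _ _) hkb hlow

lemma exists_rank_eq (hη : η ∈ n.T) (hμ : 2 ≤ n.mu η) (hb : b.Nonempty) (hbT : b ⊆ suc n.T η)
    (hwb : 4 * ((w : ℝ) + 1) ≤ n.nor η b) : ∃ m ∈ b, n.rank η m = w := by
  obtain ⟨hne, hnor⟩ := le_nor_inter_rank_le (w := w) (k := 4 * w + 2) hη hμ (by positivity) hb hbT
    (by linarith) (by linarith)
  by_contra! h
  have hlt := nor_lt_of_forall_rank_lt hη hne (inter_subset_left.trans hbT)
    fun m hm => lt_of_le_of_ne hm.2 (h m hm.1)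
  linarith

/-- The rank of `η(l)` as a successor of `η ↾ l`; a junk value if `l` is not below `lg η`. -/
noncomputable def levelRank (n : Param) (η : List ℕ) (l : ℕ) : ℕ :=
  n.rank (η.take l) (η.getD l 0)

lemma levelRank_eq_of_prefix {l : ℕ} (h : η <+: ν) (hl : l < η.length) :
    n.levelRank ν l = n.levelRank η l := by
  obtain ⟨σ, rfl⟩ := h
  rw [levelRank, levelRank, List.take_append_of_le_length hl.le, List.getD_append _ _ _ _ hl]

lemma levelRank_eq_of_prefix_or_prefix {l : ℕ} (h : η <+: ν ∨ ν <+: η) (hη : l < η.length)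
    (hν : l < ν.length) : n.levelRank η l = n.levelRank ν l :=
  h.elim (fun h => (levelRank_eq_of_prefix h hη).symm) fun h => levelRank_eq_of_prefix h hν

lemma levelRank_append_singleton (n : Param) (η : List ℕ) (m : ℕ) :
    n.levelRank (η ++ [m]) η.length = n.rank η m := by
  simp [levelRank]

end Param

namespace Q1

variable {n : Param} {p : Q1 n} {s η : List ℕ} {V : ℕ → ℕ}

lemma mem_T (hη : η ∈ p.tree) : η ∈ n.T := (p.isQ0.subset_T η hη).1

lemma suc_subset : suc p.tree η ⊆ suc n.T η := fun _ hm => mem_T hm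

lemma exists_length_eq (p : Q1 n) (l : ℕ) : ∃ η ∈ p.tree, η.length = l := by
  induction l with
  | zero => exact ⟨[], p.isQ0.prefix_mem _ p.isQ0.trunk_mem _ List.nil_prefix, rfl⟩
  | succ l ih =>
    obtain ⟨η, hη, rfl⟩ := ih
    obtain ⟨m, hm⟩ := p.isQ0.no_max η hη
    exact ⟨η ++ [m], hm, List.length_append⟩

lemma exists_levelRank_eq (hs : s ∈ p.tree) (hs1 : 1 ≤ s.length) {y : ℕ → ℕ} {j : ℕ}
    (hsj : s.length ≤ j) (hsy : ∀ l < s.length, n.levelRank s l = y l)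
    (hy : ∀ η ∈ p.tree, s.length ≤ η.length → η.length < j →
      4 * ((y η.length : ℝ) + 1) ≤ n.nor η (suc p.tree η)) :
    ∃ t ∈ p.tree, t.length = j ∧ ∀ l < j, n.levelRank t l = y l := by
  induction j, hsj using Nat.le_induction with
  | base => exact ⟨s, hs, rfl, hsy⟩
  | succ j hsj ih =>
    obtain ⟨t, ht, rfl, hty⟩ := ih fun η hη hsη hηj => hy η hη hsη (hηj.trans j.lt_succ_self)
    obtain ⟨m, hm, hrank⟩ := Param.exists_rank_eq (mem_T ht)
      (Param.two_le_mu (mem_T ht) (hs1.trans hsj)) (p.isQ0.no_max t ht) suc_subset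
      (hy t ht hsj t.length.lt_succ_self)
    refine ⟨t ++ [m], hm, List.length_append, fun l hl => ?_⟩
    rcases Nat.lt_succ_iff_lt_or_eq.1 hl with hlt | rfl
    · rw [Param.levelRank_eq_of_prefix (List.prefix_append t [m]) hlt, hty l hlt]
    · rw [Param.levelRank_append_singleton, hrank]

/-- The tree with trunk `s` obtained from the tree of `p` by bounding the ranks above `s` by `V`. -/
def pruneTree (p : Q1 n) (s : List ℕ) (V : ℕ → ℕ) : Set (List ℕ) :=
  {η ∈ p.tree | (η <+: s ∨ s <+: η) ∧
    ∀ l, s.length ≤ l → l < η.length → n.levelRank η l ≤ V l}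

lemma mem_pruneTree_of_prefix (hs : s ∈ p.tree) (hη : η <+: s) : η ∈ pruneTree p s V :=
  ⟨p.isQ0.prefix_mem s hs η hη, Or.inl hη, fun _ hsl hl => absurd hη.length_le (by lia)⟩

lemma pruneTree_prefix_mem (hη : η ∈ pruneTree p s V) {ν : List ℕ} (hν : ν <+: η) :
    ν ∈ pruneTree p s V := by
  refine ⟨p.isQ0.prefix_mem η hη.1 ν hν, ?_, fun l hsl hl => ?_⟩
  · exact hη.2.1.elim (fun h => Or.inl (hν.trans h)) (List.prefix_or_prefix_of_prefix hν)
  · rw [← Param.levelRank_eq_of_prefix hν hl]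
    exact hη.2.2 l hsl (hl.trans_le hν.length_le)

lemma suc_pruneTree (hη : η ∈ pruneTree p s V) (hsη : s <+: η) :
    suc (pruneTree p s V) η = suc p.tree η ∩ {m | n.rank η m ≤ V η.length} := by
  ext m
  refine and_congr_right fun _ => ⟨fun h => ?_, fun hm => ?_⟩
  · rw [mem_ofPred_eq, ← Param.levelRank_append_singleton]
    exact h.2 η.length hsη.length_le (by simp)
  · refine ⟨Or.inr (hsη.trans (List.prefix_append _ _)), fun l hsl hl => ?_⟩
    rw [List.length_append, List.length_singleton] at hl
    rcases Nat.lt_succ_iff_lt_or_eq.1 hl with hlt | rfl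
    · rw [Param.levelRank_eq_of_prefix (List.prefix_append η [m]) hlt]
      exact hη.2.2 l hsl hlt
    · rwa [Param.levelRank_append_singleton]

lemma le_nor_suc_pruneTree (hs1 : 1 ≤ s.length) (hη : η ∈ pruneTree p s V) (hsη : s <+: η) {k : ℝ}
    (hk : 0 < k) (hkp : k + 1 ≤ n.nor η (suc p.tree η)) (hkV : k + 2 ≤ 4 * (V η.length + 1)) :
    (suc (pruneTree p s V) η).Nonempty ∧ k ≤ n.nor η (suc (pruneTree p s V) η) := by
  have hηT := mem_T hη.1
  rw [suc_pruneTree hη hsη]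
  exact Param.le_nor_inter_rank_le hηT (Param.two_le_mu hηT (hs1.trans hsη.length_le)) hk
    (p.isQ0.no_max η hη.1) suc_subset hkp hkV

lemma two_le_nor_suc_pruneTree (hs1 : 1 ≤ s.length)
    (hp : ∀ η ∈ p.tree, s.length ≤ η.length → 3 ≤ n.nor η (suc p.tree η))
    (hη : η ∈ pruneTree p s V) (hsη : s <+: η) :
    (suc (pruneTree p s V) η).Nonempty ∧ 2 ≤ n.nor η (suc (pruneTree p s V) η) := by
  have h3 := hp η hη.1 hsη.length_le
  exact le_nor_suc_pruneTree hs1 hη hsη two_pos (by linarith)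
    (by linarith [(V η.length).cast_nonneg (α := ℝ)])

lemma exists_append_singleton_mem_pruneTree (hs : s ∈ p.tree) (hs1 : 1 ≤ s.length)
    (hp : ∀ η ∈ p.tree, s.length ≤ η.length → 3 ≤ n.nor η (suc p.tree η))
    (hη : η ∈ pruneTree p s V) : ∃ m, η ++ [m] ∈ pruneTree p s V := by
  by_cases hsη : s <+: η
  · exact (two_le_nor_suc_pruneTree hs1 hp hη hsη).1
  · have hηs : η <+: s := hη.2.1.resolve_right hsη
    have hlt : η.length < s.length :=
      hηs.length_le.lt_of_ne fun h => hsη (hηs.eq_of_length h ▸ List.prefix_refl _)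
    exact ⟨_, mem_pruneTree_of_prefix hs (List.concat_get_prefix hηs hlt)⟩

lemma uniform_pruneTree (hs1 : 1 ≤ s.length) (hV : Tendsto V atTop atTop) (N : ℕ) :
    ∃ k, s.length < k ∧ ∀ η ∈ pruneTree p s V, k ≤ η.length →
      (N : ℝ) ≤ n.nor η (suc (pruneTree p s V) η) := by
  obtain ⟨i, -, hi⟩ := p.uniform (N + 2)
  obtain ⟨j, hj⟩ := eventually_atTop.1 (hV.eventually_ge_atTop N)
  refine ⟨s.length + 1 + i + j, by lia, fun η hη hlen => ?_⟩
  have hsη : s <+: η := hη.2.1.resolve_left fun h => by have := h.length_le; lia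
  have hnor := hi η hη.1 (by lia)
  have hNV : (N : ℝ) ≤ V η.length := by exact_mod_cast hj η.length (by lia)
  push_cast at hnor
  have hN : (N : ℝ) + 1 ≤ _ := (le_nor_suc_pruneTree hs1 hη hsη (by positivity)
    (by linarith) (by linarith)).2
  linarith

lemma tendsto_nor_of_uniform {S : Set (List ℕ)}
    (hS : ∀ N : ℕ, ∃ k, ∀ η ∈ S, k ≤ η.length → (N : ℝ) ≤ n.nor η (suc S η))
    {x : ℕ → ℕ} (hx : ∀ l, res x l ∈ S) :
    Tendsto (fun l => n.nor (res x l) (suc S (res x l))) atTop atTop := by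
  refine tendsto_atTop.2 fun r => ?_
  obtain ⟨N, hN⟩ := exists_nat_ge r
  obtain ⟨k, hk⟩ := hS N
  filter_upwards [eventually_ge_atTop k] with l hl
  exact hN.trans (hk _ (hx l) (hl.trans_eq (length_res x l).symm))

/-- The condition with trunk `s` obtained from `p` by bounding the ranks above `s` by `V`. -/
def prune (p : Q1 n) (hs : s ∈ p.tree) (hs1 : 1 ≤ s.length)
    (hp : ∀ η ∈ p.tree, s.length ≤ η.length → 3 ≤ n.nor η (suc p.tree η))
    (hV : Tendsto V atTop atTop) : Q1 n where
  trunk := s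
  tree := pruneTree p s V
  isQ0 :=
    { trunk_mem := mem_pruneTree_of_prefix hs (List.prefix_refl s)
      subset_T := fun _ hη => ⟨mem_T hη.1, hη.2.1⟩
      prefix_mem := fun _ hη _ => pruneTree_prefix_mem hη
      no_max := fun _ => exists_append_singleton_mem_pruneTree hs hs1 hp
      nor_tendsto := fun _ => tendsto_nor_of_uniform fun N =>
        (uniform_pruneTree hs1 hV N).imp fun _ h => h.2
      le_nor := fun _ hη hsη => (sub_le_self 2 (one_div_nonneg.2 (n.mu_nonneg s (mem_T hs)))).trans
        (two_le_nor_suc_pruneTree hs1 hp hη hsη).2 }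
  uniform := uniform_pruneTree hs1 hV

end Q1

/-- The name of the sequence of ranks along the generic branch. -/
noncomputable def rankName (n : Param) : Forcing.RealName (Q1 n) where
  rel l w := {q | ∀ η ∈ q.tree, l < η.length → n.levelRank η l = w}
  total l p := by
    obtain ⟨k, -, hk⟩ := p.uniform 3
    obtain ⟨s, hs, hlen⟩ := p.exists_length_eq (k + l + 1)
    let q := p.prune hs (by lia)
      (fun η hη hsη => by exact_mod_cast hk η hη (by lia)) tendsto_id
    exact ⟨q, fun η hη => hη.1, n.levelRank s l, q,
      fun η hη hl => Param.levelRank_eq_of_prefix_or_prefix hη.2.1 hl (by lia), le_rfl⟩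
  functional l w w' q q' r hq hq' hqr hqr' := by
    obtain ⟨η, hη, hlen⟩ := r.exists_length_eq (l + 1)
    rw [← hq η (hqr hη) (by lia), hq' η (hqr' hη) (by lia)]

lemma forcesLe_rankName {n : Param} {p : Q1 n} {l w : ℕ}
    (h : ∀ η ∈ p.tree, l < η.length → n.levelRank η l ≤ w) : (rankName n).ForcesLe p l w := by
  intro q hpq
  obtain ⟨r, hqr, v, q', hq', hqr'⟩ := (rankName n).total l q
  obtain ⟨η, hη, hlen⟩ := r.exists_length_eq (l + 1)
  have hv : n.levelRank η l = v := hq' η (hqr' hη) (by lia)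
  exact ⟨r, hqr, v, hv ▸ h η (hpq (hqr hη)) (by lia),
    (Forcing.RealName.forcesEq_of_mem_rel hq').mono hqr'⟩

lemma isReduction_rankName {n : Param} {p : Q1 n} {s : List ℕ} {W : ℕ → ℕ} (hs : s ∈ p.tree)
    (hs1 : 1 ≤ s.length) (hW : ∀ η ∈ p.tree, s.length ≤ η.length →
      4 * ((W η.length : ℝ) + 1) ≤ n.nor η (suc p.tree η)) :
    (rankName n).IsReduction p s.length (n.levelRank s) W := by
  intro j hsj y hys hyW V hV
  have hnor (η : List ℕ) (hη : η ∈ p.tree) (hsη : s.length ≤ η.length) (hηj : η.length < j) :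
      4 * ((y η.length : ℝ) + 1) ≤ n.nor η (suc p.tree η) := by
    have hyW' : (y η.length : ℝ) ≤ W η.length := by exact_mod_cast hyW _ hsη hηj
    linarith [hW η hη hsη]
  obtain ⟨t, ht, rfl, hty⟩ := Q1.exists_levelRank_eq hs hs1 hsj (fun l hl => (hys l hl).symm) hnor
  have hnor3 (η : List ℕ) (hη : η ∈ p.tree) (htη : t.length ≤ η.length) :
      3 ≤ n.nor η (suc p.tree η) := by
    linarith [hW η hη (hsj.trans htη), (W η.length).cast_nonneg (α := ℝ)]
  refine ⟨p.prune ht (hs1.trans hsj) hnor3 hV, fun η hη => hη.1, fun l hl => ?_, fun l hl => ?_⟩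
  · refine Forcing.RealName.forcesEq_of_mem_rel fun η hη hlη => ?_
    rw [Param.levelRank_eq_of_prefix_or_prefix hη.2.1 hlη hl, hty l hl]
  · exact forcesLe_rankName fun η hη => hη.2.2 l hl

theorem isSlowGeneric_rankName (n : Param) : (rankName n).IsSlowGeneric := by
  intro p
  choose K _ hK using p.uniform
  obtain ⟨W, hW, hKW⟩ := Forcing.exists_tendsto_comp_le fun w => K (4 * (w + 1))
  obtain ⟨s, hs, hlen⟩ := p.exists_length_eq (K (4 * (0 + 1)) + 1)
  refine ⟨s.length, n.levelRank s, W, hW,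
    isReduction_rankName hs (by lia) fun η hη hsη => ?_⟩
  exact_mod_cast hK (4 * (W η.length + 1)) η hη (hKW _ (by lia))

end TreeCreature

theorem claim7 (n : TreeCreature.Param) :
    (∃ τ : Forcing.RealName (TreeCreature.Q1 n), τ.IsDominating) ∧
      (∃ ρ : Forcing.RealName (TreeCreature.Q1 n), ρ.IsHechler) := by
  have hρ := Forcing.RealName.isHechler_firstBit (TreeCreature.isSlowGeneric_rankName n)
  exact ⟨⟨_, hρ.isDominating⟩, ⟨_, hρ⟩⟩
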